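/- For $L\ge 2$ and $\alpha\in\mathbb R$ let $\mu_L(\alpha)=(1-\alpha)(1,\alpha,\dots,\alpha^{L-1})\in\mathbb R^L$ be the impulse response of the scalar linear dynamical system with parameter $\alpha$, and let $\mu_L(\alpha_1,\dots,\alpha_h)\in\mathbb R^{h\times L}$ be the matrix with rows $\mu_L(\alpha_i)$. Let $Z\in\mathbb R^{L\times L}$, $Z_{ij}=\frac{2}{(i+j)^3-(i+j)}$ for $1\le i,j\le L$, and let $\phi_1,\dots,\phi_L$ be an orthonormal basis of eigenvectors of $Z$ in order of decreasing eigenvalue (the spectral filters of length $L$). For $k\le L$ let $\Phi_{1:k}\in\mathbb R^{k\times L}$ be the matrix with rows $\phi_1,\dots,\phi_k$. Consider the following algorithm. Draw independent random $\alpha_1,\dots,\alpha_h\in[0,1]$ whose laws have no atoms (for example, uniform). For each $i$ let $$m_i\in\arg\min_{m\in\mathbb R^k}\ \mathbb E_u\bigl[\,|m^\top\Phi_{1:k}u-\mu_L(\alpha_i)^\top u|^2\,\bigr],$$ where $u\in\mathbb R^L$ is a random input with $\mathbb E[uu^\top]=sI$ for some $s>0$ (for example, standard Gaussian). Let $M\in\mathbb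 R^{h\times k}$ be the matrix with rows $m_i$, and return its Moore--Penrose pseudo-inverse $\widetilde M\in\mathbb R^{k\times h}$. There is an absolute constant $c>0$ such that for all $L\ge 2$, all $k\le L$ and all $h\ge k$, and for every choice of spectral filters and of laws of $u$ and of the $\alpha_i$ as above, the following holds with probability one: the minimizers $m_i$ are unique, $M$ has full column rank (so that $\widetilde M M=I_k$), and $$\bigl\|\Phi_{1:k}-\widetilde M\,\mu_L(\alpha_1,\dots,\alpha_h)\bigr\|_F\ \le\ c\,\lambda_{\max}\,h\,e^{-k/\log L},$$ where $\lambda_{\max}$ is the largest singular value of $\widetilde M$ and $\|\cdot\|_F$ is the Frobenius norm (which dominates the operator norm). -/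

import Mathlib

open MeasureTheory ProbabilityTheory

noncomputable section

/-- The impulse response `μ_L(α) = (1 - α) (1, α, α², …, α^(L-1))` of the scalar linear dynamical
system `x_t = α x_{t-1} + u_t`, `y_t = (1 - α) x_t`. -/
def impulseResponse (L : ℕ) (α : ℝ) : Fin L → ℝ :=
  fun i => (1 - α) * α ^ (i : ℕ)

/-- The `h × L` matrix `μ_L(α₁, …, α_h)` whose `i`-th row is `μ_L(α_i)`. -/
def impulseMatrix (L : ℕ) {h : ℕ} (α : Fin h → ℝ) : Matrix (Fin h) (Fin L) ℝ :=
  Matrix.of fun i => impulseResponse L (α i)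

/-- The Hankel matrix of spectral filtering, `Z_{ij} = 2 / ((i + j)³ - (i + j))` for
`1 ≤ i, j ≤ L` (here the indices start at `0`). It equals `∫₀¹ μ_L(α) μ_L(α)ᵀ dα`. -/
def spectralHankel (L : ℕ) : Matrix (Fin L) (Fin L) ℝ :=
  Matrix.of fun i j =>
    2 / ((((i : ℕ) : ℝ) + ((j : ℕ) : ℝ) + 2) ^ 3 - (((i : ℕ) : ℝ) + ((j : ℕ) : ℝ) + 2))

/-- `Φ` holds the first `k` spectral filters of length `L`: its rows are the first `k` members of
an orthonormal basis of eigenvectors of the Hankel matrix, listed by decreasing eigenvalue. -/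
def IsSpectralFilters (L k : ℕ) (Φ : Matrix (Fin k) (Fin L) ℝ) : Prop :=
  ∃ (V : Matrix (Fin L) (Fin L) ℝ) (σ : Fin L → ℝ),
    V * V.transpose = 1 ∧ Antitone σ ∧
    (∀ j, (spectralHankel L).mulVec (V j) = σ j • V j) ∧
    ∃ hk : k ≤ L, ∀ j, Φ j = V (Fin.castLE hk j)

/-- The law `ν` of the random input `u ∈ ℝ^L` is white: the coordinates are square integrable and
`E[u uᵀ]` is a positive multiple of the identity (as for standard Gaussian inputs). -/
def IsWhite {L : ℕ} (ν : Measure (Fin L → ℝ)) : Prop :=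
  (∀ i, MemLp (fun u : Fin L → ℝ => u i) 2 ν) ∧
    ∃ s : ℝ, 0 < s ∧ ∀ i j, ∫ u, u i * u j ∂ν = if i = j then s else 0

/-- The expected squared error `E_u |mᵀ Φ u - μ_L(α)ᵀ u|²` of the spectral coefficients `m`. -/
def fitLoss {L k : ℕ} (ν : Measure (Fin L → ℝ)) (Φ : Matrix (Fin k) (Fin L) ℝ) (α : ℝ)
    (m : Fin k → ℝ) : ℝ :=
  ∫ u, |dotProduct m (Φ.mulVec u) - dotProduct (impulseResponse L α) u| ^ 2 ∂ν

/-- `m` is a spectral representation of the scalar system with parameter `α`: a minimizer of the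
expected squared error over `ℝ^k`. -/
def IsSpectralRepresentation {L k : ℕ} (ν : Measure (Fin L → ℝ)) (Φ : Matrix (Fin k) (Fin L) ℝ)
    (α : ℝ) (m : Fin k → ℝ) : Prop :=
  ∀ m' : Fin k → ℝ, fitLoss ν Φ α m ≤ fitLoss ν Φ α m'

/-- `B` is the Moore-Penrose pseudo-inverse of the real matrix `A`. -/
structure IsMoorePenroseInverse {m n : ℕ} (A : Matrix (Fin m) (Fin n) ℝ)
    (B : Matrix (Fin n) (Fin m) ℝ) : Prop where
  mul_mul_left : A * B * A = A
  mul_mul_right : B * A * B = B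
  symm_left : (A * B).transpose = A * B
  symm_right : (B * A).transpose = B * A

/-- With filters `Φ` and sampled parameters `α₁, …, α_h`, the algorithm computes the `h × k`
coefficient matrix `M`, whose rows are spectral representations of the `α_i`, and returns its
pseudo-inverse `Mt`. -/
structure IsAlgorithmRun {L k h : ℕ} (ν : Measure (Fin L → ℝ)) (Φ : Matrix (Fin k) (Fin L) ℝ)
    (α : Fin h → ℝ) (M : Matrix (Fin h) (Fin k) ℝ) (Mt : Matrix (Fin k) (Fin h) ℝ) : Prop where
  rows : ∀ i, IsSpectralRepresentation ν Φ (α i) (M i)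
  pinv : IsMoorePenroseInverse M Mt

/-- The largest singular value of a real matrix. -/
def maxSingularValue {m n : ℕ} (A : Matrix (Fin m) (Fin n) ℝ) : ℝ :=
  (Matrix.toEuclideanLin A).singularValues 0

/-- The Frobenius norm of a real matrix. -/
def frobNorm {m n : ℕ} (A : Matrix (Fin m) (Fin n) ℝ) : ℝ :=
  Real.sqrt (∑ i, ∑ j, A i j ^ 2)

end

/-!
For white inputs and orthonormal filters, the loss of `m` is a multiple of
`‖m - Φ μ(α)‖² + ‖μ(α) - Φᵀ Φ μ(α)‖²`. So the spectral representation is the projection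
`m = Φ μ(α)`, `M = A Φᵀ` with `A = μ(α₁, …, α_h)`, and `Φ - M⁺ A = -M⁺ (A - M Φ)` as soon as
`M⁺ M = 1`; the rows of `A - M Φ` are the projection residuals of the `μ(αᵢ)`. Full column rank is
almost sure because a nonzero combination of the entries of `Φ μ(x)` is a nonzero polynomial in
`x`, which hits its finitely many zeros with probability zero.

Since `Z = ∫₀¹ μ(α) μ(α)ᵀ dα`, the mean over `α ∈ [0, 1]` of the squared residual is the sum of the
eigenvalues of `Z` beyond the `k`-th. As `μ` is `1/2`-Hölder continuous, the mean controls the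
residual at every single `α`.

The eigenvalues decay like those of the Hilbert matrix `1 / (x + y)`, `x` and `y` half-integers,
which dominates `Z`. If `B` is a Blaschke product with `j` zeros, then `(1 - B(x) B(y)) / (x + y)`
has rank at most `j`, so by Courant–Fischer the `j`-th eigenvalue (counted from zero) is at most
`sup |B|² (1 + log L)`. Zeros at the dyadic scales up to `L`, each used about `j / log L` times,
make `B` exponentially small in `j / log L`.
-/

open scoped Matrix

section SingularValues

theorem norm_apply_le_singularValues_zero_mul_norm {𝕜 E F : Type*} [RCLike 𝕜]
    [NormedAddCommGroup E] [InnerProductSpace 𝕜 E] [FiniteDimensional 𝕜 E]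
    [NormedAddCommGroup F] [InnerProductSpace 𝕜 F] [FiniteDimensional 𝕜 F]
    (T : E →ₗ[𝕜] F) (v : E) : ‖T v‖ ≤ T.singularValues 0 * ‖v‖ := by
  have hT := T.isSymmetric_adjoint_comp_self
  let b := hT.eigenvectorBasis rfl
  have eigenvalue_le (i) : hT.eigenvalues rfl i ≤ T.singularValues 0 ^ 2 := by
    rw [← T.sq_singularValues_fin rfl i]
    exact pow_le_pow_left₀ (T.singularValues_nonneg _) (T.singularValues_antitone (Nat.zero_le _)) 2
  have inner_apply (i) : inner 𝕜 (b i) ((T.adjoint ∘ₗ T) v)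
      = hT.eigenvalues rfl i * inner 𝕜 (b i) v := by
    rw [← hT, hT.apply_eigenvectorBasis rfl i, inner_smul_left, RCLike.conj_ofReal]
  have norm_sq_apply : ‖T v‖ ^ 2 = ∑ i, hT.eigenvalues rfl i * ‖inner 𝕜 (b i) v‖ ^ 2 := by
    rw [← inner_self_eq_norm_sq (𝕜 := 𝕜), ← LinearMap.adjoint_inner_right,
      ← LinearMap.comp_apply, ← b.sum_inner_mul_inner, map_sum]
    refine Finset.sum_congr rfl fun i _ => ?_
    rw [inner_apply, mul_left_comm, RCLike.re_ofReal_mul, ← inner_conj_symm v, RCLike.conj_mul,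
      ← RCLike.ofReal_pow, RCLike.ofReal_re]
  refine pow_le_pow_iff_left₀ (norm_nonneg _)
    (mul_nonneg (T.singularValues_nonneg _) (norm_nonneg _)) two_ne_zero |>.1 ?_
  rw [norm_sq_apply, mul_pow, ← b.sum_sq_norm_inner_right v, Finset.mul_sum]
  exact Finset.sum_le_sum fun i _ => mul_le_mul_of_nonneg_right (eigenvalue_le i) (sq_nonneg _)

theorem maxSingularValue_nonneg {m n : ℕ} (A : Matrix (Fin m) (Fin n) ℝ) :
    0 ≤ maxSingularValue A :=
  LinearMap.singularValues_nonneg _ _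

theorem sum_mulVec_sq_le_maxSingularValue {m n : ℕ} (A : Matrix (Fin m) (Fin n) ℝ)
    (x : Fin n → ℝ) : ∑ i, (A *ᵥ x) i ^ 2 ≤ maxSingularValue A ^ 2 * ∑ j, x j ^ 2 := by
  have h := pow_le_pow_left₀ (norm_nonneg _)
    (norm_apply_le_singularValues_zero_mul_norm A.toEuclideanLin (WithLp.toLp 2 x)) 2
  rw [mul_pow, EuclideanSpace.norm_sq_eq, EuclideanSpace.norm_sq_eq] at h
  simpa [maxSingularValue, Matrix.toLpLin_toLp] using h

theorem frobNorm_mul_le {m n l : ℕ} (A : Matrix (Fin m) (Fin n) ℝ)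
    (B : Matrix (Fin n) (Fin l) ℝ) : frobNorm (A * B) ≤ maxSingularValue A * frobNorm B := by
  refine Real.sqrt_le_iff.2 ⟨mul_nonneg (maxSingularValue_nonneg A) (Real.sqrt_nonneg _), ?_⟩
  rw [mul_pow, frobNorm, Real.sq_sqrt (by positivity), Finset.sum_comm,
    Finset.sum_comm (f := fun i j => B i j ^ 2), Finset.mul_sum]
  exact Finset.sum_le_sum fun j _ => sum_mulVec_sq_le_maxSingularValue A (B.col j)

theorem frobNorm_neg {m n : ℕ} (A : Matrix (Fin m) (Fin n) ℝ) : frobNorm (-A) = frobNorm A := by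
  simp only [frobNorm, Matrix.neg_apply, neg_sq]

theorem frobNorm_sub_mul_le_of_leftInverse {k h L : ℕ} {B : Matrix (Fin k) (Fin h) ℝ}
    {M : Matrix (Fin h) (Fin k) ℝ} (hBM : B * M = 1) (Φ : Matrix (Fin k) (Fin L) ℝ)
    (A : Matrix (Fin h) (Fin L) ℝ) :
    frobNorm (Φ - B * A) ≤ maxSingularValue B * frobNorm (A - M * Φ) := by
  have factor : Φ - B * A = -(B * (A - M * Φ)) := by
    rw [Matrix.mul_sub, ← Matrix.mul_assoc, hBM, Matrix.one_mul, neg_sub]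
  rw [factor, frobNorm_neg]
  exact frobNorm_mul_le B _

end SingularValues

section MoorePenrose

variable {m n : ℕ} {A : Matrix (Fin m) (Fin n) ℝ} {B C : Matrix (Fin n) (Fin m) ℝ}

theorem IsMoorePenroseInverse.unique (hB : IsMoorePenroseInverse A B)
    (hC : IsMoorePenroseInverse A C) : B = C := by
  have left_eq : A * B = A * C := by
    calc A * B = (A * C * (A * B))ᵀ := by rw [← Matrix.mul_assoc, hC.mul_mul_left, hB.symm_left]
      _ = A * B * (A * C) := by rw [Matrix.transpose_mul, hB.symm_left, hC.symm_left]
      _ = A * C := by rw [← Matrix.mul_assoc, hB.mul_mul_left]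
  have right_eq : B * A = C * A := by
    calc B * A = (B * A * (C * A))ᵀ := by
          rw [Matrix.mul_assoc, ← Matrix.mul_assoc A, hC.mul_mul_left, hB.symm_right]
      _ = C * A * (B * A) := by rw [Matrix.transpose_mul, hB.symm_right, hC.symm_right]
      _ = C * A := by rw [Matrix.mul_assoc, ← Matrix.mul_assoc A, hB.mul_mul_left]
  calc B = B * A * B := hB.mul_mul_right.symm
    _ = C * A * C := by rw [right_eq, Matrix.mul_assoc, left_eq, Matrix.mul_assoc]
    _ = C := hC.mul_mul_right

theorem exists_isMoorePenroseInverse_of_mulVec_injective (hA : Function.Injective A.mulVec) :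
    ∃ B, IsMoorePenroseInverse A B ∧ B * A = 1 := by
  have gram_isUnit : IsUnit (Aᵀ * A) := by
    rw [← Matrix.mulVec_injective_iff_isUnit, ← Matrix.coe_mulVecLin, ← LinearMap.ker_eq_bot,
      Matrix.ker_mulVecLin_transpose_mul_self, LinearMap.ker_eq_bot, Matrix.coe_mulVecLin]
    exact hA
  have left_inv : (Aᵀ * A)⁻¹ * Aᵀ * A = 1 := by
    rw [Matrix.mul_assoc, Matrix.nonsing_inv_mul _ ((Matrix.isUnit_iff_isUnit_det _).1 gram_isUnit)]
  refine ⟨(Aᵀ * A)⁻¹ * Aᵀ, ⟨?_, ?_, ?_, ?_⟩, left_inv⟩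
  · rw [Matrix.mul_assoc, left_inv, Matrix.mul_one]
  · rw [left_inv, Matrix.one_mul]
  · rw [Matrix.transpose_mul, Matrix.transpose_mul, Matrix.transpose_nonsing_inv,
      Matrix.transpose_mul, Matrix.transpose_transpose, Matrix.mul_assoc]
  · rw [left_inv, Matrix.transpose_one]

end MoorePenrose

section Unisolvence

variable {E R : Type*} [CommRing R]

theorem det_of_eval_cons {n : ℕ} (f : Fin (n + 1) → E → R) (x : E) (y : Fin n → E) :
    (Matrix.of fun i j => f j ((Fin.cons x y : Fin (n + 1) → E) i)).det =
      ∑ j : Fin (n + 1),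
        (-1) ^ (j : ℕ) * (Matrix.of fun i l => f (j.succAbove l) (y i)).det * f j x := by
  rw [Matrix.det_succ_row_zero]
  refine Finset.sum_congr rfl fun j _ => ?_
  rw [mul_right_comm]
  rfl

variable [MeasurableSpace E] [MeasurableSpace R] [MeasurableAdd₂ R] [MeasurableMul₂ R]

theorem measurable_det_of_eval {n : ℕ} {f : Fin n → E → R} (hf : ∀ j, Measurable (f j)) :
    Measurable fun x : Fin n → E => (Matrix.of fun i j => f j (x i)).det := by
  simp only [Matrix.det_apply', Matrix.of_apply]
  fun_prop

variable [MeasurableSingletonClass R]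

-- Expanded along its first row, the determinant is a combination of the `f j` evaluated at the
-- first point; its coefficients are minors, one of which is nonzero by induction.
theorem ae_pi_det_ne_zero [Nontrivial R] {n : ℕ} {f : Fin n → E → R} (hf : ∀ j, Measurable (f j))
    (μ : Fin n → Measure E) [∀ i, SigmaFinite (μ i)]
    (hμ : ∀ c : Fin n → R, c ≠ 0 → ∀ i, μ i {x | ∑ j, c j * f j x = 0} = 0) :
    ∀ᵐ x ∂Measure.pi μ, (Matrix.of fun i j => f j (x i)).det ≠ 0 := by
  induction n with
  | zero => exact .of_forall fun x => by simp
  | succ n ih =>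
    have minor_ne_zero := ih (fun j => hf j.succ) (fun i => μ (Fin.succAbove 0 i))
      fun c hc i => by
        have cons_ne_zero : (Fin.cons 0 c : Fin (n + 1) → R) ≠ 0 := fun h0 =>
          hc (funext fun j => congrFun h0 j.succ)
        simpa [Fin.sum_univ_succ] using hμ _ cons_ne_zero (Fin.succAbove 0 i)
    have mp := (measurePreserving_piFinSuccAbove μ 0).symm
    have singular_measurable :
        MeasurableSet {x : Fin (n + 1) → E | (Matrix.of fun i j => f j (x i)).det = 0} :=
      measurable_det_of_eval hf (measurableSet_singleton 0)
    rw [ae_iff]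
    simp only [ne_eq, not_not]
    rw [← mp.measure_preimage singular_measurable.nullMeasurableSet,
      Measure.prod_apply_symm (mp.measurable singular_measurable), lintegral_eq_zero_iff
        (measurable_measure_prodMk_right (mp.measurable singular_measurable))]
    filter_upwards [minor_ne_zero] with y hy
    let cofactor (j : Fin (n + 1)) : R :=
      (-1) ^ (j : ℕ) * (Matrix.of fun i l => f (j.succAbove l) (y i)).det
    have cofactor_ne_zero : cofactor ≠ 0 := fun h0 => hy (by simpa [cofactor] using congrFun h0 0)
    refine measure_mono_null (fun x hx => ?_) (hμ cofactor cofactor_ne_zero 0)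
    rw [Set.mem_ofPred_eq, ← det_of_eval_cons, ← Fin.insertNth_zero']
    exact hx

variable {Ω : Type*} [MeasurableSpace Ω] {P : Measure Ω}

theorem ae_mulVec_injective_of_iIndepFun [IsDomain R] {n h : ℕ} (hnh : n ≤ h) {f : Fin n → E → R}
    (hf : ∀ j, Measurable (f j)) {X : Fin h → Ω → E} (hX : ∀ i, Measurable (X i))
    (hind : iIndepFun X P)
    (hP : ∀ c : Fin n → R, c ≠ 0 → ∀ i, P {ω | ∑ j, c j * f j (X i ω) = 0} = 0) :
    ∀ᵐ ω ∂P, Function.Injective (Matrix.of fun i j => f j (X i ω)).mulVec := by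
  let Y (i : Fin n) := X (Fin.castLE hnh i)
  have hY (i) : Measurable (Y i) := hX _
  have := hind.isProbabilityMeasure
  have : ∀ i, IsProbabilityMeasure (P.map (Y i)) := fun i =>
    Measure.isProbabilityMeasure_map (hY i).aemeasurable
  have det_ne_zero := ae_pi_det_ne_zero hf (fun i => P.map (Y i)) fun c hc i => by
    rw [Measure.map_apply (hY i)]
    · exact hP c hc _
    · exact (Finset.measurable_sum _ fun j _ => (hf j).const_mul (c j)) (measurableSet_singleton 0)
  rw [← (hind.precomp (Fin.castLE_injective hnh)).map_fun_eq_pi_map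
    fun i => (hY i).aemeasurable] at det_ne_zero
  filter_upwards [ae_of_ae_map (measurable_pi_lambda _ hY).aemeasurable det_ne_zero] with ω hω
  refine (injective_iff_map_eq_zero (Matrix.mulVecLin _)).2 fun v hv => ?_
  by_contra v_ne_zero
  exact hω (Matrix.exists_mulVec_eq_zero_iff.1
    ⟨v, v_ne_zero, funext fun i => congrFun hv (Fin.castLE hnh i)⟩)

end Unisolvence

theorem finite_setOf_dotProduct_impulseResponse_eq_zero {L : ℕ} {w : Fin L → ℝ} (hw : w ≠ 0) :
    {x | w ⬝ᵥ impulseResponse L x = 0}.Finite := by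
  let p : Polynomial ℝ := ∑ i : Fin L, Polynomial.monomial i (w i)
  have coeff_p (i : Fin L) : p.coeff i = w i := by
    simp [p, Polynomial.finsetSum_coeff, Polynomial.coeff_monomial, Fin.val_inj]
  have p_ne_zero : p ≠ 0 := fun h0 => hw (funext fun i => by rw [← coeff_p, h0]; simp)
  have dotProduct_eq (x : ℝ) : w ⬝ᵥ impulseResponse L x = (1 - x) * p.eval x := by
    simp only [p, Polynomial.eval_finsetSum, Polynomial.eval_monomial, dotProduct,
      impulseResponse, Finset.mul_sum]
    exact Finset.sum_congr rfl fun i _ => by ring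
  refine ((Set.finite_singleton 1).union p.roots.toFinset.finite_toSet).subset fun x hx => ?_
  rw [Set.mem_ofPred_eq, dotProduct_eq, mul_eq_zero, sub_eq_zero] at hx
  simpa [p_ne_zero, eq_comm (a := x)] using hx

theorem ae_mulVec_injective_impulseMatrix_mul_transpose {L k h : ℕ} (hkh : k ≤ h)
    {Φ : Matrix (Fin k) (Fin L) ℝ} (hΦ : Φ * Φᵀ = 1) {Ω : Type*} [MeasurableSpace Ω]
    {P : Measure Ω} {α : Fin h → Ω → ℝ} (hα : ∀ i, Measurable (α i)) (hind : iIndepFun α P)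
    (hatom : ∀ i x, P {ω | α i ω = x} = 0) :
    ∀ᵐ ω ∂P, Function.Injective (impulseMatrix L (fun i => α i ω) * Φᵀ).mulVec := by
  have meas (j : Fin k) : Measurable fun x => impulseResponse L x ⬝ᵥ Φ j := by
    unfold dotProduct impulseResponse
    fun_prop
  refine ae_mulVec_injective_of_iIndepFun hkh meas hα hind fun c hc i => ?_
  have vecMul_ne_zero : c ᵥ* Φ ≠ 0 := fun h0 => hc <| by
    rw [← Matrix.vecMul_one c, ← hΦ, ← Matrix.vecMul_vecMul, h0, Matrix.zero_vecMul]
  have zeros_eq : {ω | ∑ j, c j * (impulseResponse L (α i ω) ⬝ᵥ Φ j) = 0} =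
      ⋃ x ∈ {x | (c ᵥ* Φ) ⬝ᵥ impulseResponse L x = 0}, {ω | α i ω = x} := by
    ext ω
    simp only [Set.mem_ofPred_eq, ← Matrix.dotProduct_mulVec, dotProduct_comm (impulseResponse _ _),
      Set.mem_iUnion, exists_prop, exists_eq_right']
    rfl
  rw [zeros_eq, measure_biUnion_null_iff
    (finite_setOf_dotProduct_impulseResponse_eq_zero vecMul_ne_zero).countable]
  exact fun x _ => hatom i x

section Blaschke

/-- The finite Blaschke product of the right half-plane with zeros `p 0, …, p (j - 1)`, as a
function of the variable `x`. -/
noncomputable def blaschke {K : Type*} [Field K] (p : ℕ → K) (j : ℕ) (x : K) : K :=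
  ∏ m ∈ Finset.range j, (x - p m) / (x + p m)

theorem blaschke_zero {K : Type*} [Field K] (p : ℕ → K) (x : K) : blaschke p 0 x = 1 := rfl

theorem blaschke_add {K : Type*} [Field K] (p : ℕ → K) (i j : ℕ) (x : K) :
    blaschke p (i + j) x = blaschke p i x * blaschke (fun m => p (i + m)) j x :=
  Finset.prod_range_add _ _ _

theorem one_div_add_eq_sum_blaschke {K : Type*} [Field K] {p : ℕ → K} {x y : K}
    (hx : ∀ m, x + p m ≠ 0) (hy : ∀ m, y + p m ≠ 0) (hxy : x + y ≠ 0) (j : ℕ) :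
    1 / (x + y) = (∑ m ∈ Finset.range j, 2 * p m * (blaschke p m x / (x + p m)) *
      (blaschke p m y / (y + p m))) + blaschke p j x * blaschke p j y / (x + y) := by
  induction j with
  | zero => simp [blaschke_zero]
  | succ j ih =>
    rw [Finset.sum_range_succ, ih, add_assoc]
    have := hx j
    have := hy j
    simp only [blaschke, Finset.prod_range_succ]
    field_simp
    ring

variable {K : Type*} [Field K] [LinearOrder K] [IsStrictOrderedRing K]

theorem abs_blaschke_le_one {p : ℕ → K} (hp : ∀ m, 0 ≤ p m) {x : K} (hx : 0 ≤ x) (j : ℕ) :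
    |blaschke p j x| ≤ 1 := by
  rw [blaschke, Finset.abs_prod]
  refine Finset.prod_le_one (fun _ _ => abs_nonneg _) fun m _ => ?_
  rw [abs_div]
  exact div_le_one_of_le₀ (abs_le_abs (by linarith [hp m]) (by linarith)) (abs_nonneg _)

theorem abs_blaschke_antitone {p : ℕ → K} (hp : ∀ m, 0 ≤ p m) {x : K} (hx : 0 ≤ x) :
    Antitone fun j => |blaschke p j x| := by
  refine antitone_nat_of_succ_le fun j => ?_
  rw [blaschke_add, abs_mul]
  exact mul_le_of_le_one_right (abs_nonneg _) (abs_blaschke_le_one (fun m => hp (j + m)) hx 1)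

theorem abs_blaschke_mul_le_pow_of_periodic {p : ℕ → K} {N : ℕ} (hp : Function.Periodic p N)
    {x r : K} (h : |blaschke p N x| ≤ r) (q : ℕ) : |blaschke p (N * q) x| ≤ r ^ q := by
  induction q with
  | zero => simp [blaschke_zero]
  | succ q ih =>
    have shift_eq : (fun m => p (N * q + m)) = p := by
      funext m
      rw [add_comm, mul_comm, ← smul_eq_mul, hp.nsmul]
    rw [mul_add, mul_one, blaschke_add, shift_eq, abs_mul, pow_succ]
    exact mul_le_mul ih h (abs_nonneg _) ((abs_nonneg _).trans ih)

end Blaschke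

section DyadicNodes

theorem exp_four_le : Real.exp 4 ≤ 58 := by
  calc Real.exp 4 = Real.exp 1 ^ 4 := by rw [← Real.exp_nat_mul]; norm_num
    _ ≤ 2.7182818286 ^ 4 := pow_le_pow_left₀ (Real.exp_pos 1).le Real.exp_one_lt_d9.le 4
    _ ≤ 58 := by norm_num

theorem abs_blaschke_four_dyadic_le {x p : ℝ} (hp : 0 < p) (h1 : 2 * p ≤ x) (h2 : x ≤ 4 * p) :
    |blaschke (fun m => 2 ^ m * p) 4 x| ≤ Real.exp (-4) := by
  have hx : 0 < x := by linarith
  have outer : |(x - p) / (x + p) * ((x - 8 * p) / (x + 8 * p))| ≤ 1 / 2 := by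
    rw [div_mul_div_comm, abs_div, abs_of_nonpos (by nlinarith), abs_of_pos (by positivity),
      div_le_iff₀ (by positivity)]
    nlinarith
  have inner : |(x - 2 * p) / (x + 2 * p) * ((x - 4 * p) / (x + 4 * p))| ≤ 1 / 29 := by
    rw [div_mul_div_comm, abs_div, abs_of_nonpos (by nlinarith), abs_of_pos (by positivity),
      div_le_iff₀ (by positivity)]
    nlinarith [sq_nonneg (x - 2.8 * p), mul_pos hp hx]
  have split : blaschke (fun m => 2 ^ m * p) 4 x =
      (x - p) / (x + p) * ((x - 8 * p) / (x + 8 * p)) *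
        ((x - 2 * p) / (x + 2 * p) * ((x - 4 * p) / (x + 4 * p))) := by
    simp only [blaschke, Finset.prod_range_succ, Finset.prod_range_zero]
    ring
  calc |blaschke (fun m => 2 ^ m * p) 4 x| ≤ 1 / 2 * (1 / 29) := by
        rw [split, abs_mul]
        exact mul_le_mul outer inner (abs_nonneg _) (by norm_num)
    _ = (58 : ℝ)⁻¹ := by norm_num
    _ ≤ Real.exp (-4) := by
        rw [Real.exp_neg]
        exact inv_anti₀ (Real.exp_pos 4) exp_four_le

/-- The points `1/4, 1/2, 1, …, 2^(N-3)`, repeated periodically. As zeros of a Blaschke product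
they make it small on the half-integers below `2^(N-4)`. -/
noncomputable def dyadicNode (N m : ℕ) : ℝ := 2 ^ (m % N) / 4

theorem dyadicNode_pos (N m : ℕ) : 0 < dyadicNode N m := by
  unfold dyadicNode
  positivity

theorem dyadicNode_periodic (N : ℕ) : Function.Periodic (dyadicNode N) N := fun m => by
  simp only [dyadicNode, Nat.add_mod_right]

theorem abs_blaschke_dyadicNode_period_le {L n : ℕ} (hn : n < L) :
    |blaschke (dyadicNode (Nat.log 2 L + 5)) (Nat.log 2 L + 5) (n + 1 / 2)| ≤ Real.exp (-4) := by
  set N := Nat.log 2 L + 5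
  set a := Nat.log 2 (2 * n + 1)
  have node_nonneg (m) : 0 ≤ dyadicNode N m := (dyadicNode_pos N m).le
  have x_nonneg : (0 : ℝ) ≤ n + 1 / 2 := by positivity
  have a_add_four_le : a + 4 ≤ N := by
    have : a ≤ Nat.log 2 (L * 2) := Nat.log_mono_right (by omega)
    rw [Nat.log_mul_base one_lt_two (by omega)] at this
    omega
  have pow_le : (2 : ℝ) ^ a ≤ 2 * n + 1 := by
    exact_mod_cast Nat.pow_log_le_self 2 (2 * n).succ_ne_zero
  have le_pow : (2 * n + 1 : ℝ) ≤ 2 * 2 ^ a := by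
    exact_mod_cast pow_succ' 2 a ▸ (Nat.lt_pow_succ_log_self one_lt_two (2 * n + 1)).le
  have four_nodes : blaschke (fun m => dyadicNode N (a + m)) 4 (n + 1 / 2) =
      blaschke (fun m => 2 ^ m * (2 ^ a / 4)) 4 (n + 1 / 2 : ℝ) := by
    refine Finset.prod_congr rfl fun m hm => ?_
    have : a + m < N := by
      have := Finset.mem_range.1 hm
      omega
    simp only [dyadicNode, Nat.mod_eq_of_lt this, pow_add]
    ring
  refine (abs_blaschke_antitone node_nonneg x_nonneg a_add_four_le).trans ?_
  simp only [blaschke_add, abs_mul, four_nodes]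
  exact (mul_le_of_le_one_left (abs_nonneg _) (abs_blaschke_le_one node_nonneg x_nonneg a)).trans
    (abs_blaschke_four_dyadic_le (by positivity) (by linarith) (by linarith))

theorem abs_blaschke_dyadicNode_le {L n : ℕ} (hn : n < L) (j : ℕ) :
    |blaschke (dyadicNode (Nat.log 2 L + 5)) j (n + 1 / 2)| ≤
      Real.exp (-4) ^ (j / (Nat.log 2 L + 5)) :=
  (abs_blaschke_antitone (fun m => (dyadicNode_pos _ m).le) (by positivity)
    (Nat.mul_div_le j _)).trans
  (abs_blaschke_mul_le_pow_of_periodic (dyadicNode_periodic _)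
    (abs_blaschke_dyadicNode_period_le hn) _)

end DyadicNodes

section OrthonormalRows

theorem submatrix_mul_transpose_eq_one {ι κ n R : Type*} [Fintype n] [DecidableEq ι]
    [DecidableEq κ] [NonAssocSemiring R] {V : Matrix ι n R} (hV : V * Vᵀ = 1) {f : κ → ι}
    (hf : Function.Injective f) : V.submatrix f id * (V.submatrix f id)ᵀ = 1 := by
  rw [Matrix.transpose_submatrix, ← Matrix.submatrix_mul _ _ _ _ _ Function.bijective_id, hV,
    Matrix.submatrix_one _ hf]

end OrthonormalRows

section QuadraticForms

theorem integral_dotProduct_sq {E ι : Type*} [MeasurableSpace E] [Fintype ι] {μ : Measure E}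
    {f : E → ι → ℝ} (hf : ∀ i j, Integrable (fun x => f x i * f x j) μ) (v : ι → ℝ) :
    ∫ x, (v ⬝ᵥ f x) ^ 2 ∂μ = v ⬝ᵥ (Matrix.of fun i j => ∫ x, f x i * f x j ∂μ) *ᵥ v := by
  have sq_eq (x : E) : (v ⬝ᵥ f x) ^ 2 = ∑ i, ∑ j, v i * (f x i * f x j * v j) := by
    rw [sq, dotProduct, Finset.sum_mul_sum]
    exact Finset.sum_congr rfl fun i _ => Finset.sum_congr rfl fun j _ => by ring
  have term_integrable (i j : ι) : Integrable (fun x => v i * (f x i * f x j * v j)) μ :=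
    ((hf i j).mul_const _).const_mul _
  simp only [sq_eq]
  rw [integral_finsetSum _ fun i _ => integrable_finsetSum _ fun j _ => term_integrable i j]
  simp only [integral_finsetSum _ fun j _ => term_integrable _ j, integral_const_mul,
    integral_mul_const, dotProduct, Matrix.mulVec, Matrix.of_apply, Finset.mul_sum]

theorem intervalIntegral_dotProduct_sq {ι : Type*} [Fintype ι] {f : ℝ → ι → ℝ}
    (hf : Continuous f) (v : ι → ℝ) :
    ∫ x in (0 : ℝ)..1, (v ⬝ᵥ f x) ^ 2 =
      v ⬝ᵥ (Matrix.of fun i j => ∫ x in (0 : ℝ)..1, f x i * f x j) *ᵥ v := by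
  simp only [intervalIntegral.integral_of_le zero_le_one]
  refine integral_dotProduct_sq (fun i j => ?_) v
  exact (by fun_prop : Continuous fun x => f x i * f x j).integrableOn_Ioc

variable {K ι κ n : Type*} [Field K] [LinearOrder K] [IsStrictOrderedRing K]
  [Fintype ι] [Fintype κ] [Fintype n]

-- The Schur test with constant weights.
theorem dotProduct_mulVec_le_of_row_sum_le {A : Matrix n n K} (hA : A.IsSymm)
    (hA0 : ∀ i j, 0 ≤ A i j) {C : K} (hC : ∀ i, ∑ j, A i j ≤ C) (v : n → K) :
    v ⬝ᵥ A *ᵥ v ≤ C * (v ⬝ᵥ v) := by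
  have swap : ∑ i, ∑ j, A i j * v j ^ 2 = ∑ i, ∑ j, A i j * v i ^ 2 := by
    rw [Finset.sum_comm]
    simp only [hA.apply]
  calc v ⬝ᵥ A *ᵥ v = ∑ i, ∑ j, A i j * (v i * v j) := by
        simp only [dotProduct, Matrix.mulVec, Finset.mul_sum, mul_left_comm]
    _ ≤ ∑ i, ∑ j, A i j * ((v i ^ 2 + v j ^ 2) / 2) := by
        gcongr with i _ j _
        · exact hA0 i j
        · linarith [two_mul_le_add_sq (v i) (v j)]
    _ = ∑ i, (∑ j, A i j) * v i ^ 2 := by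
        simp only [add_div, mul_add, Finset.sum_add_distrib, ← mul_div_assoc, ← Finset.sum_div,
          swap, add_halves, Finset.sum_mul]
    _ ≤ ∑ i, C * v i ^ 2 := by
        gcongr with i
        exact hC i
    _ = C * (v ⬝ᵥ v) := by simp only [dotProduct, Finset.mul_sum, sq]

-- One half of the Courant–Fischer principle: fewer linear constraints than eigenvectors leave room
-- for a nonzero vector in the span of the eigenvectors.
theorem exists_mulVec_eq_zero_le_dotProduct_mulVec [DecidableEq ι] {A : Matrix n n K}
    {W : Matrix ι n K} (hW : W * Wᵀ = 1) {τ : ι → K} (hA : ∀ i, A *ᵥ W i = τ i • W i) {t : K}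
    (ht : ∀ i, t ≤ τ i) (G : Matrix κ n K) (hcard : Fintype.card κ < Fintype.card ι) :
    ∃ v ≠ 0, G *ᵥ v = 0 ∧ t * (v ⬝ᵥ v) ≤ v ⬝ᵥ A *ᵥ v := by
  obtain ⟨c, hGc, hc⟩ := (Submodule.ne_bot_iff _).1 <|
    LinearMap.ker_ne_bot_of_finrank_lt (f := (G * Wᵀ).mulVecLin) (by simpa using hcard)
  set v := Wᵀ *ᵥ c with hv
  have mulVec_v : W *ᵥ v = c := by rw [hv, Matrix.mulVec_mulVec, hW, Matrix.one_mulVec]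
  have v_dotProduct (u : n → K) : v ⬝ᵥ u = c ⬝ᵥ W *ᵥ u := by
    rw [hv, Matrix.mulVec_transpose, ← Matrix.dotProduct_mulVec]
  have A_mulVec_v : W *ᵥ A *ᵥ v = fun i => τ i * c i := by
    have : A * Wᵀ = Wᵀ * Matrix.diagonal τ := by
      ext a i
      rw [Matrix.mul_diagonal, mul_comm]
      exact congrFun (hA i) a
    rw [hv, Matrix.mulVec_mulVec c A, this, Matrix.mulVec_mulVec, ← Matrix.mul_assoc, hW,
      Matrix.one_mul]
    exact funext (Matrix.mulVec_diagonal τ c)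
  refine ⟨v, fun hv0 => hc ?_, ?_, ?_⟩
  · rw [← mulVec_v, hv0, Matrix.mulVec_zero]
  · rw [hv, Matrix.mulVec_mulVec]
    exact hGc
  · rw [v_dotProduct, v_dotProduct, A_mulVec_v, mulVec_v, dotProduct, dotProduct, Finset.mul_sum]
    refine Finset.sum_le_sum fun i _ => ?_
    nlinarith [mul_le_mul_of_nonneg_right (ht i) (mul_self_nonneg (c i))]

end QuadraticForms

section HilbertMatrix

/-- The symmetric Cauchy matrix `1 / (xᵢ + xₗ)` with nodes `x`. -/
def cauchyMatrix {ι K : Type*} [Field K] (x : ι → K) : Matrix ι ι K :=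
  Matrix.of fun i l => 1 / (x i + x l)

theorem dotProduct_cauchyMatrix_mulVec_eq_blaschke {ι K : Type*} [Fintype ι] [Field K]
    {p : ℕ → K} {x : ι → K} (hp : ∀ i m, x i + p m ≠ 0) (hx : ∀ i l, x i + x l ≠ 0) {j : ℕ}
    {v : ι → K} (hv : ∀ m < j, (fun i => blaschke p m (x i) / (x i + p m)) ⬝ᵥ v = 0) :
    v ⬝ᵥ cauchyMatrix x *ᵥ v =
      (fun i => blaschke p j (x i) * v i) ⬝ᵥ cauchyMatrix x *ᵥ
        fun i => blaschke p j (x i) * v i := by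
  let g (m : ℕ) (i : ι) : K := blaschke p m (x i) / (x i + p m)
  have kernel_eq (i l : ι) : v i * (cauchyMatrix x i l * v l) =
      (∑ m ∈ Finset.range j, 2 * p m * (g m i * v i) * (g m l * v l)) +
        blaschke p j (x i) * v i * (cauchyMatrix x i l * (blaschke p j (x l) * v l)) := by
    have expansion := one_div_add_eq_sum_blaschke (hp i) (hp l) (hx i l) j
    calc v i * (cauchyMatrix x i l * v l) = v i * v l * (1 / (x i + x l)) := by
          rw [cauchyMatrix, Matrix.of_apply]
          ring
      _ = _ := by
          rw [expansion, mul_add, Finset.mul_sum]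
          congr 1
          · exact Finset.sum_congr rfl fun m _ => by ring
          · rw [cauchyMatrix, Matrix.of_apply]
            ring
  have rank_one_vanish (i : ι) :
      ∑ l, ∑ m ∈ Finset.range j, 2 * p m * (g m i * v i) * (g m l * v l) = 0 := by
    rw [Finset.sum_comm]
    refine Finset.sum_eq_zero fun m hm => ?_
    rw [← Finset.mul_sum]
    exact mul_eq_zero_of_right _ (hv m (Finset.mem_range.1 hm))
  simp only [dotProduct, Matrix.mulVec, Finset.mul_sum, kernel_eq, Finset.sum_add_distrib,
    rank_one_vanish, zero_add]

/-- The Hilbert matrix `1 / (i + l + 1)`, `0 ≤ i, l < L`, presented as a Cauchy matrix with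
half-integer nodes. -/
noncomputable def hilbertMatrix (L : ℕ) : Matrix (Fin L) (Fin L) ℝ :=
  cauchyMatrix fun i => (i : ℝ) + 1 / 2

theorem hilbertMatrix_apply {L : ℕ} (i l : Fin L) :
    hilbertMatrix L i l = ((i : ℝ) + l + 1)⁻¹ := by
  rw [hilbertMatrix, cauchyMatrix, Matrix.of_apply, one_div]
  ring_nf

theorem dotProduct_hilbertMatrix_mulVec_le {L : ℕ} (v : Fin L → ℝ) :
    v ⬝ᵥ hilbertMatrix L *ᵥ v ≤ (1 + Real.log L) * (v ⬝ᵥ v) := by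
  refine dotProduct_mulVec_le_of_row_sum_le (Matrix.IsSymm.ext fun i l => ?_) (fun i l => ?_)
    (fun i => ?_) v
  · rw [hilbertMatrix_apply, hilbertMatrix_apply, add_comm (l : ℝ)]
  · rw [hilbertMatrix_apply]
    positivity
  · calc ∑ l, hilbertMatrix L i l ≤ ∑ l : Fin L, ((l : ℝ) + 1)⁻¹ := by
          refine Finset.sum_le_sum fun l _ => ?_
          rw [hilbertMatrix_apply]
          exact inv_anti₀ (by positivity) (by linarith [Nat.cast_nonneg (α := ℝ) i])
      _ = harmonic L := by
          rw [Fin.sum_univ_eq_sum_range fun l => ((l : ℝ) + 1)⁻¹, harmonic]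
          push_cast
          rfl
      _ ≤ 1 + Real.log L := harmonic_le_one_add_log L

theorem integral_dotProduct_pow_sq {L : ℕ} (v : Fin L → ℝ) :
    ∫ α in (0 : ℝ)..1, (v ⬝ᵥ fun i => α ^ (i : ℕ)) ^ 2 = v ⬝ᵥ hilbertMatrix L *ᵥ v := by
  rw [intervalIntegral_dotProduct_sq (by fun_prop)]
  congr 2
  ext i l
  simp only [Matrix.of_apply, ← pow_add, integral_pow, hilbertMatrix_apply]
  simp

end HilbertMatrix

section SpectralHankel

@[fun_prop]
theorem continuous_impulseResponse (L : ℕ) : Continuous (impulseResponse L) := by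
  unfold impulseResponse
  fun_prop

theorem integral_dotProduct_impulseResponse_sq {L : ℕ} (v : Fin L → ℝ) :
    ∫ α in (0 : ℝ)..1, (v ⬝ᵥ impulseResponse L α) ^ 2 = v ⬝ᵥ spectralHankel L *ᵥ v := by
  rw [intervalIntegral_dotProduct_sq (continuous_impulseResponse L)]
  congr 2
  ext i l
  have expand (α : ℝ) : impulseResponse L α i * impulseResponse L α l =
      α ^ (i + l : ℕ) - 2 * α ^ (i + l + 1 : ℕ) + α ^ (i + l + 2 : ℕ) := by
    simp only [impulseResponse]
    ring
  simp only [Matrix.of_apply, expand, spectralHankel]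
  rw [intervalIntegral.integral_add (Continuous.intervalIntegrable (by fun_prop) _ _)
      (Continuous.intervalIntegrable (by fun_prop) _ _),
    intervalIntegral.integral_sub (Continuous.intervalIntegrable (by fun_prop) _ _)
      (Continuous.intervalIntegrable (by fun_prop) _ _),
    intervalIntegral.integral_const_mul, integral_pow, integral_pow, integral_pow]
  push_cast
  have cubic (s : ℝ) : (s + 2) ^ 3 - (s + 2) = (s + 1) * (s + 1 + 1) * (s + 2 + 1) := by ring
  rw [cubic]
  simp only [one_pow, ne_eq, Nat.add_eq_zero_iff, one_ne_zero, and_false, not_false_eq_true,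
    zero_pow, sub_zero, OfNat.ofNat_ne_zero]
  field_simp
  ring

theorem dotProduct_spectralHankel_mulVec_le {L : ℕ} (v : Fin L → ℝ) :
    v ⬝ᵥ spectralHankel L *ᵥ v ≤ v ⬝ᵥ hilbertMatrix L *ᵥ v := by
  rw [← integral_dotProduct_impulseResponse_sq, ← integral_dotProduct_pow_sq]
  refine intervalIntegral.integral_mono_on zero_le_one
    (Continuous.intervalIntegrable (by unfold dotProduct; fun_prop) _ _)
    (Continuous.intervalIntegrable (by unfold dotProduct; fun_prop) _ _) fun α hα => ?_
  have dotProduct_eq : v ⬝ᵥ impulseResponse L α = (1 - α) * (v ⬝ᵥ fun i => α ^ (i : ℕ)) :=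
    dotProduct_smul (1 - α) v fun i => α ^ (i : ℕ)
  rw [dotProduct_eq, mul_pow]
  exact mul_le_of_le_one_left (sq_nonneg _)
    (pow_le_one₀ (by linarith [hα.2]) (by linarith [hα.1]))

variable {L : ℕ} {V : Matrix (Fin L) (Fin L) ℝ} {σ : Fin L → ℝ}

theorem eigenvalue_spectralHankel_le_of_abs_blaschke_le (hV : V * Vᵀ = 1) (hσ : Antitone σ)
    (hZ : ∀ j, spectralHankel L *ᵥ V j = σ j • V j) {p : ℕ → ℝ} (hp : ∀ m, 0 ≤ p m)
    (j : Fin L) {R : ℝ} (hR : ∀ i : Fin L, |blaschke p j (i + 1 / 2)| ≤ R) :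
    σ j ≤ R ^ 2 * (1 + Real.log L) := by
  let G : Matrix (Fin j) (Fin L) ℝ :=
    Matrix.of fun m i => blaschke p m ((i : ℝ) + 1 / 2) / (i + 1 / 2 + p m)
  obtain ⟨v, v_ne_zero, hGv, le_hankel⟩ := exists_mulVec_eq_zero_le_dotProduct_mulVec
    (ι := Set.Iic j) (submatrix_mul_transpose_eq_one hV Subtype.val_injective) (fun i => hZ i)
    (fun i => hσ i.2) G (by simp)
  let w (i : Fin L) : ℝ := blaschke p j (i + 1 / 2) * v i
  have hilbert_eq : v ⬝ᵥ hilbertMatrix L *ᵥ v = w ⬝ᵥ hilbertMatrix L *ᵥ w :=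
    dotProduct_cauchyMatrix_mulVec_eq_blaschke
      (fun i m => ne_of_gt (add_pos_of_pos_of_nonneg (by positivity) (hp m)))
      (fun i l => by positivity) fun m hm => congrFun hGv ⟨m, hm⟩
  have w_le : w ⬝ᵥ w ≤ R ^ 2 * (v ⬝ᵥ v) := by
    simp only [dotProduct, Finset.mul_sum, ← sq, w, mul_pow]
    exact Finset.sum_le_sum fun i _ =>
      mul_le_mul_of_nonneg_right (sq_le_sq.2 ((hR i).trans (le_abs_self R))) (sq_nonneg _)
  have v_pos : 0 < v ⬝ᵥ v := by simpa using Matrix.dotProduct_star_self_pos_iff.2 v_ne_zero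
  refine le_of_mul_le_mul_right ?_ v_pos
  calc σ j * (v ⬝ᵥ v) ≤ v ⬝ᵥ spectralHankel L *ᵥ v := le_hankel
    _ ≤ w ⬝ᵥ hilbertMatrix L *ᵥ w := hilbert_eq ▸ dotProduct_spectralHankel_mulVec_le v
    _ ≤ (1 + Real.log L) * (w ⬝ᵥ w) := dotProduct_hilbertMatrix_mulVec_le w
    _ ≤ (1 + Real.log L) * (R ^ 2 * (v ⬝ᵥ v)) :=
        mul_le_mul_of_nonneg_left w_le (by linarith [Real.log_natCast_nonneg L])
    _ = R ^ 2 * (1 + Real.log L) * (v ⬝ᵥ v) := by ring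

end SpectralHankel

section Residual

variable {κ n R : Type*} [Fintype κ] [Fintype n]

/-- The difference between `w` and its projection `Φᵀ Φ w` to the row space of `Φ`; the encoding
presumes that the rows of `Φ` are orthonormal. -/
def rowResidual [NonUnitalNonAssocRing R] (Φ : Matrix κ n R) (w : n → R) : n → R :=
  w - (Φ *ᵥ w) ᵥ* Φ

/-- The squared Euclidean length of `rowResidual Φ w`. -/
def residualEnergy [NonUnitalNonAssocRing R] (Φ : Matrix κ n R) (w : n → R) : R :=
  rowResidual Φ w ⬝ᵥ rowResidual Φ w

theorem rowResidual_sub [NonUnitalNonAssocRing R] (Φ : Matrix κ n R) (v w : n → R) :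
    rowResidual Φ (v - w) = rowResidual Φ v - rowResidual Φ w := by
  simp only [rowResidual, Matrix.mulVec_sub, Matrix.sub_vecMul]
  abel

theorem dotProduct_self_vecMul_sub [CommRing R] [DecidableEq κ] {Φ : Matrix κ n R}
    (hΦ : Φ * Φᵀ = 1) (m : κ → R) (w : n → R) :
    (m ᵥ* Φ - w) ⬝ᵥ (m ᵥ* Φ - w) =
      (m - Φ *ᵥ w) ⬝ᵥ (m - Φ *ᵥ w) + residualEnergy Φ w := by
  have mulVec_vecMul (c : κ → R) : Φ *ᵥ (c ᵥ* Φ) = c := by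
    rw [← Matrix.mulVec_transpose, Matrix.mulVec_mulVec, hΦ, Matrix.one_mulVec]
  have w_dotProduct (c : κ → R) : w ⬝ᵥ c ᵥ* Φ = Φ *ᵥ w ⬝ᵥ c := by
    rw [dotProduct_comm, ← Matrix.dotProduct_mulVec, dotProduct_comm]
  simp only [residualEnergy, rowResidual, sub_dotProduct, dotProduct_sub,
    ← Matrix.dotProduct_mulVec, mulVec_vecMul, w_dotProduct, dotProduct_comm m (Φ *ᵥ w)]
  ring

theorem dotProduct_self_eq_add_residualEnergy [CommRing R] [DecidableEq κ] {Φ : Matrix κ n R}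
    (hΦ : Φ * Φᵀ = 1) (w : n → R) :
    w ⬝ᵥ w = Φ *ᵥ w ⬝ᵥ Φ *ᵥ w + residualEnergy Φ w := by
  simpa using dotProduct_self_vecMul_sub hΦ 0 w

theorem dotProduct_self_nonneg [Ring R] [LinearOrder R] [IsStrictOrderedRing R] (v : n → R) :
    0 ≤ v ⬝ᵥ v :=
  Finset.sum_nonneg fun i _ => mul_self_nonneg (v i)

theorem residualEnergy_le_dotProduct_self [CommRing R] [LinearOrder R] [IsStrictOrderedRing R]
    [DecidableEq κ] {Φ : Matrix κ n R} (hΦ : Φ * Φᵀ = 1) (w : n → R) :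
    residualEnergy Φ w ≤ w ⬝ᵥ w := by
  rw [dotProduct_self_eq_add_residualEnergy hΦ w]
  exact le_add_of_nonneg_left (dotProduct_self_nonneg _)

theorem residualEnergy_le_two_mul_add [CommRing R] [LinearOrder R] [IsStrictOrderedRing R]
    (Φ : Matrix κ n R) (v w : n → R) :
    residualEnergy Φ v ≤ 2 * residualEnergy Φ w + 2 * residualEnergy Φ (v - w) := by
  have parallelogram := dotProduct_self_nonneg (rowResidual Φ v - (2 : R) • rowResidual Φ w)
  simp only [residualEnergy, rowResidual_sub, sub_dotProduct, dotProduct_sub, smul_dotProduct,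
    dotProduct_smul, dotProduct_comm (rowResidual Φ w) (rowResidual Φ v), smul_eq_mul]
    at parallelogram ⊢
  linarith

theorem sum_sub_mul_sq_eq_sum_residualEnergy {ι : Type*} [Fintype ι] [CommRing R]
    (A : Matrix ι n R) (Φ : Matrix κ n R) :
    ∑ i, ∑ j, (A - A * Φᵀ * Φ) i j ^ 2 = ∑ i, residualEnergy Φ (A i) := by
  refine Finset.sum_congr rfl fun i _ => ?_
  have row_eq : (A - A * Φᵀ * Φ) i = rowResidual Φ (A i) := by
    rw [rowResidual, ← Matrix.vecMul_transpose]
    rfl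
  simp only [row_eq, residualEnergy, dotProduct, sq]

end Residual

section ImpulseResponse

variable {L : ℕ} {α β : ℝ}

theorem impulseResponse_nonneg (hα : α ∈ Set.Icc (0 : ℝ) 1) (i : Fin L) :
    0 ≤ impulseResponse L α i :=
  mul_nonneg (sub_nonneg.2 hα.2) (pow_nonneg hα.1 _)

theorem impulseResponse_le_one_sub (hα : α ∈ Set.Icc (0 : ℝ) 1) (i : Fin L) :
    impulseResponse L α i ≤ 1 - α :=
  mul_le_of_le_one_right (sub_nonneg.2 hα.2) (pow_le_one₀ hα.1 hα.2)

theorem sum_impulseResponse_le_one (L : ℕ) (hα : 0 ≤ α) : ∑ i, impulseResponse L α i ≤ 1 := by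
  simp only [impulseResponse, ← Finset.mul_sum, Fin.sum_univ_eq_sum_range fun i => α ^ i]
  rw [mul_neg_geom_sum]
  exact sub_le_self 1 (pow_nonneg hα L)

theorem dotProduct_self_impulseResponse_le_one (L : ℕ) (hα : α ∈ Set.Icc (0 : ℝ) 1) :
    impulseResponse L α ⬝ᵥ impulseResponse L α ≤ 1 := by
  refine (Finset.sum_le_sum fun i _ => ?_).trans (sum_impulseResponse_le_one L hα.1)
  exact mul_le_of_le_one_left (impulseResponse_nonneg hα i)
    ((impulseResponse_le_one_sub hα i).trans (sub_le_self 1 hα.1))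

theorem abs_impulseResponse_sub_le (hα : α ∈ Set.Icc (0 : ℝ) 1) (hβ : β ∈ Set.Icc (0 : ℝ) 1)
    (i : Fin L) : |impulseResponse L α i - impulseResponse L β i| ≤ |α - β| := by
  wlog hαβ : α ≤ β generalizing α β
  · rw [abs_sub_comm, abs_sub_comm α]
    exact this hβ hα (le_of_not_ge hαβ)
  obtain ⟨i, hi⟩ := i
  induction i with
  | zero => simp [impulseResponse, abs_sub_comm]
  | succ i ih =>
    have ih := ih (i.lt_succ_self.trans hi)
    have le_one_sub := impulseResponse_le_one_sub hβ (⟨i, i.lt_succ_self.trans hi⟩ : Fin L)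
    have nonneg := impulseResponse_nonneg hβ (⟨i, i.lt_succ_self.trans hi⟩ : Fin L)
    simp only [impulseResponse, abs_of_nonpos (sub_nonpos.2 hαβ)] at ih le_one_sub nonneg ⊢
    have succ_sub : (1 - α) * α ^ (i + 1) - (1 - β) * β ^ (i + 1) =
        α * ((1 - α) * α ^ i - (1 - β) * β ^ i) + (α - β) * ((1 - β) * β ^ i) := by ring
    rw [succ_sub, abs_le]
    rw [abs_le] at ih
    constructor <;> nlinarith [hα.1]

-- The norm is bounded through `‖·‖₂² ≤ ‖·‖_∞ ‖·‖₁`.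
theorem dotProduct_self_impulseResponse_sub_le (L : ℕ) (hα : α ∈ Set.Icc (0 : ℝ) 1)
    (hβ : β ∈ Set.Icc (0 : ℝ) 1) :
    (impulseResponse L α - impulseResponse L β) ⬝ᵥ (impulseResponse L α - impulseResponse L β) ≤
      2 * |α - β| := by
  have sum_abs_le : ∑ i, |impulseResponse L α i - impulseResponse L β i| ≤ 2 := by
    calc ∑ i, |impulseResponse L α i - impulseResponse L β i|
        ≤ ∑ i, (impulseResponse L α i + impulseResponse L β i) := by
          gcongr with i
          rw [abs_le]
          constructor <;> linarith [impulseResponse_nonneg hα i, impulseResponse_nonneg hβ i]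
      _ ≤ 2 := by
          rw [Finset.sum_add_distrib]
          linarith [sum_impulseResponse_le_one L hα.1, sum_impulseResponse_le_one L hβ.1]
  calc _ = ∑ i, |impulseResponse L α i - impulseResponse L β i| *
          |impulseResponse L α i - impulseResponse L β i| := by
        simp only [dotProduct, Pi.sub_apply, abs_mul_abs_self]
    _ ≤ ∑ i, |α - β| * |impulseResponse L α i - impulseResponse L β i| := by
        refine Finset.sum_le_sum fun i _ => ?_
        exact mul_le_mul_of_nonneg_right (abs_impulseResponse_sub_le hα hβ i) (abs_nonneg _)
    _ ≤ 2 * |α - β| := by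
        rw [← Finset.mul_sum, mul_comm]
        gcongr

end ImpulseResponse

section PointwiseFromMean

theorem exists_Icc_subset_unitInterval_mem {x d : ℝ} (hx : x ∈ Set.Icc (0 : ℝ) 1)
    (hd : d ∈ Set.Icc (0 : ℝ) 1) : ∃ a, 0 ≤ a ∧ a + d ≤ 1 ∧ x ∈ Set.Icc a (a + d) := by
  obtain ⟨hx0, hx1⟩ := hx
  obtain ⟨hd0, hd1⟩ := hd
  refine ⟨x * (1 - d), mul_nonneg hx0 (by linarith), ?_, ?_, ?_⟩ <;> nlinarith

-- `q` stays above `q x / 4` on an interval of length `q x / (2 * K)` around `x`.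
theorem sq_le_mul_integral_of_le_two_mul_add {q : ℝ → ℝ} {K : ℝ} (hK : 0 < K)
    (hq : IntervalIntegrable q volume 0 1) (hq0 : ∀ x, 0 ≤ q x)
    (hmod : ∀ x ∈ Set.Icc (0 : ℝ) 1, ∀ y ∈ Set.Icc (0 : ℝ) 1, q x ≤ 2 * q y + K * |x - y|)
    {x : ℝ} (hx : x ∈ Set.Icc (0 : ℝ) 1) (hxK : q x ≤ 2 * K) :
    q x ^ 2 ≤ 8 * K * ∫ y in (0 : ℝ)..1, q y := by
  set d := q x / (2 * K) with hd
  have q_eq : q x = 2 * K * d := by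
    rw [hd]
    field_simp
  have d_nonneg : 0 ≤ d := div_nonneg (hq0 x) (by positivity)
  obtain ⟨a, a_nonneg, a_add_le, hxa⟩ :=
    exists_Icc_subset_unitInterval_mem hx ⟨d_nonneg, div_le_one_of_le₀ hxK (by positivity)⟩
  have quarter_le : ∀ y ∈ Set.Icc a (a + d), q x / 4 ≤ q y := fun y hy => by
    have dist_le : |x - y| ≤ d := by
      rw [abs_le]
      constructor <;> linarith [hxa.1, hxa.2, hy.1, hy.2]
    have := hmod x hx y ⟨a_nonneg.trans hy.1, hy.2.trans a_add_le⟩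
    linarith [mul_le_mul_of_nonneg_left dist_le hK.le]
  have local_integral : d * (q x / 4) ≤ ∫ y in a..(a + d), q y := by
    have := intervalIntegral.integral_mono_on (by linarith) (intervalIntegrable_const (μ := volume))
      (hq.mono_set ?_) quarter_le
    · simpa [mul_div_assoc] using this
    · rw [Set.uIcc_of_le (by linarith), Set.uIcc_of_le zero_le_one]
      exact Set.Icc_subset_Icc a_nonneg a_add_le
  have mono : ∫ y in a..(a + d), q y ≤ ∫ y in (0 : ℝ)..1, q y :=
    intervalIntegral.integral_mono_interval a_nonneg (by linarith) a_add_le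
      (Filter.Eventually.of_forall hq0) hq
  calc q x ^ 2 = 8 * K * (d * (q x / 4)) := by
        rw [q_eq]
        ring
    _ ≤ 8 * K * ∫ y in (0 : ℝ)..1, q y := by
        gcongr
        exact local_integral.trans mono

@[fun_prop]
theorem continuous_residualEnergy {κ n : Type*} [Fintype κ] [Fintype n] (Φ : Matrix κ n ℝ) :
    Continuous (residualEnergy Φ) := by
  unfold residualEnergy rowResidual
  fun_prop

theorem residualEnergy_impulseResponse_sq_le {κ : Type*} [Fintype κ] [DecidableEq κ] {L : ℕ}
    {Φ : Matrix κ (Fin L) ℝ} (hΦ : Φ * Φᵀ = 1) {α : ℝ} (hα : α ∈ Set.Icc (0 : ℝ) 1) :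
    residualEnergy Φ (impulseResponse L α) ^ 2 ≤
      32 * ∫ β in (0 : ℝ)..1, residualEnergy Φ (impulseResponse L β) := by
  have le_one : residualEnergy Φ (impulseResponse L α) ≤ 1 :=
    (residualEnergy_le_dotProduct_self hΦ _).trans (dotProduct_self_impulseResponse_le_one L hα)
  have key := sq_le_mul_integral_of_le_two_mul_add (K := 4)
    (q := fun β => residualEnergy Φ (impulseResponse L β)) (by norm_num)
    (Continuous.intervalIntegrable (by fun_prop) _ _) (fun _ => dotProduct_self_nonneg _)
    (fun x hx y hy => ?_) hα (by linarith)
  · linarith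
  · have increment := (residualEnergy_le_dotProduct_self hΦ _).trans
      (dotProduct_self_impulseResponse_sub_le L hx hy)
    linarith [residualEnergy_le_two_mul_add Φ (impulseResponse L x) (impulseResponse L y)]

end PointwiseFromMean

section EigenvalueDecay

variable {L : ℕ} {V : Matrix (Fin L) (Fin L) ℝ} {σ : Fin L → ℝ}

theorem eventually_natLog_add_le_mul_log {b : ℕ} (hb : 1 < b) {c : ℝ} (hc : 1 < c * Real.log b)
    (a : ℝ) : ∀ᶠ n : ℕ in Filter.atTop, (Nat.log b n : ℝ) + a ≤ c * Real.log n := by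
  have log_b_pos : 0 < Real.log b := Real.log_pos (by exact_mod_cast hb)
  have gap_pos : 0 < c - 1 / Real.log b := sub_pos.2 ((div_lt_iff₀ log_b_pos).2 hc)
  have gap_tendsto := (Real.tendsto_log_atTop.comp tendsto_natCast_atTop_atTop).const_mul_atTop
    gap_pos
  filter_upwards [gap_tendsto.eventually_ge_atTop a] with n hn
  have natLog_le : (Nat.log b n : ℝ) ≤ 1 / Real.log b * Real.log n := by
    rw [one_div_mul_eq_div]
    exact Real.natLog_le_logb n b
  simp only [Function.comp_apply] at hn
  linarith

theorem exp_neg_four_pow_div_sq_le {N : ℕ} {ℓ : ℝ} (hN : 0 < N) (hNℓ : N ≤ 2 * ℓ) (j : ℕ) :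
    (Real.exp (-4) ^ (j / N)) ^ 2 ≤ Real.exp 8 * Real.exp (-(4 / ℓ)) ^ j := by
  have floor_ge : j / (2 * ℓ) - 1 ≤ (j / N : ℕ) := by
    have lt_floor := Nat.lt_floor_add_one ((j : ℝ) / N)
    rw [Nat.floor_div_eq_div] at lt_floor
    have : (j : ℝ) / (2 * ℓ) ≤ j / N :=
      div_le_div_of_nonneg_left j.cast_nonneg (Nat.cast_pos.2 hN) hNℓ
    linarith
  rw [← Real.exp_nat_mul, ← Real.exp_nat_mul, ← Real.exp_nat_mul, ← Real.exp_add,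
    Real.exp_le_exp]
  have exponent_eq : (j : ℝ) * -(4 / ℓ) = -8 * (j / (2 * ℓ)) := by ring
  rw [exponent_eq, Nat.cast_ofNat]
  linarith

theorem eigenvalue_spectralHankel_le (hV : V * Vᵀ = 1) (hσ : Antitone σ)
    (hZ : ∀ j, spectralHankel L *ᵥ V j = σ j • V j) (hL : Nat.log 2 L + 5 ≤ 2 * Real.log L)
    (j : Fin L) :
    σ j ≤ Real.exp 8 * (1 + Real.log L) * Real.exp (-(4 / Real.log L)) ^ (j : ℕ) := by
  calc σ j ≤ (Real.exp (-4) ^ (j / (Nat.log 2 L + 5) : ℕ)) ^ 2 * (1 + Real.log L) :=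
        eigenvalue_spectralHankel_le_of_abs_blaschke_le hV hσ hZ
          (fun m => (dyadicNode_pos _ m).le) j fun i => abs_blaschke_dyadicNode_le i.2 j
    _ ≤ Real.exp 8 * Real.exp (-(4 / Real.log L)) ^ (j : ℕ) * (1 + Real.log L) := by
        gcongr
        exact exp_neg_four_pow_div_sq_le (by positivity) (by exact_mod_cast hL) j
    _ = _ := by ring

end EigenvalueDecay

section Tail

variable {L k : ℕ} {V : Matrix (Fin L) (Fin L) ℝ} {σ : Fin L → ℝ}

theorem residualEnergy_submatrix {κ n R : Type*} [Fintype κ] [Fintype n] [DecidableEq n]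
    [CommRing R] {V : Matrix n n R} (hV : V * Vᵀ = 1) (f : κ ↪ n) (w : n → R) :
    residualEnergy (V.submatrix f id) w = ∑ j ∈ (Finset.univ.map f)ᶜ, (V j ⬝ᵥ w) ^ 2 := by
  classical
  have pythagoras := dotProduct_self_eq_add_residualEnergy
    (submatrix_mul_transpose_eq_one hV f.injective) w
  have parseval : w ⬝ᵥ w = ∑ j, (V j ⬝ᵥ w) ^ 2 := by
    have mulVec_vecMul : (V *ᵥ w) ᵥ* V = w := by
      rw [← Matrix.mulVec_transpose, Matrix.mulVec_mulVec, mul_eq_one_comm.1 hV, Matrix.one_mulVec]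
    calc w ⬝ᵥ w = V *ᵥ w ⬝ᵥ V *ᵥ w := by rw [Matrix.dotProduct_mulVec, mulVec_vecMul]
      _ = ∑ j, (V j ⬝ᵥ w) ^ 2 := by
        simp only [sq]
        rfl
  rw [parseval, ← Finset.sum_compl_add_sum (Finset.univ.map f), Finset.sum_map] at pythagoras
  have rows_eq : V.submatrix f id *ᵥ w ⬝ᵥ V.submatrix f id *ᵥ w = ∑ j, (V (f j) ⬝ᵥ w) ^ 2 := by
    simp only [sq]
    rfl
  rw [rows_eq, add_comm] at pythagoras
  exact (add_left_cancel pythagoras).symm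

theorem integral_residualEnergy_submatrix_impulseResponse {κ : Type*} [Fintype κ]
    (hV : V * Vᵀ = 1) (hZ : ∀ j, spectralHankel L *ᵥ V j = σ j • V j) (f : κ ↪ Fin L) :
    ∫ α in (0 : ℝ)..1, residualEnergy (V.submatrix f id) (impulseResponse L α) =
      ∑ j ∈ (Finset.univ.map f)ᶜ, σ j := by
  simp only [residualEnergy_submatrix hV]
  rw [intervalIntegral.integral_finsetSum fun i _ => Continuous.intervalIntegrable
    (by unfold dotProduct; fun_prop) _ _]
  refine Finset.sum_congr rfl fun j _ => ?_
  have row_unit : V j ⬝ᵥ V j = 1 := by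
    simpa [Matrix.mul_apply, dotProduct] using congrFun (congrFun hV j) j
  rw [integral_dotProduct_impulseResponse_sq, hZ, dotProduct_smul, row_unit, smul_eq_mul, mul_one]

theorem sum_compl_map_castLEEmb {M : Type*} [AddCommGroup M] (hk : k ≤ L) (g : ℕ → M) :
    ∑ j ∈ (Finset.univ.map (Fin.castLEEmb hk))ᶜ, g j = ∑ j ∈ Finset.Ico k L, g j := by
  rw [Finset.sum_Ico_eq_sub g hk, eq_sub_iff_add_eq, ← Fin.sum_univ_eq_sum_range,
    ← Fin.sum_univ_eq_sum_range, ← Finset.sum_compl_add_sum (Finset.univ.map (Fin.castLEEmb hk)),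
    Finset.sum_map]
  rfl

theorem inv_one_sub_exp_neg_le {t : ℝ} (ht : 0 < t) : (1 - Real.exp (-t))⁻¹ ≤ 1 + t⁻¹ := by
  have exp_le : Real.exp (-t) ≤ (t + 1)⁻¹ := by
    rw [Real.exp_neg]
    exact inv_anti₀ (by positivity) (Real.add_one_le_exp t)
  calc (1 - Real.exp (-t))⁻¹ ≤ (1 - (t + 1)⁻¹)⁻¹ := by
        refine inv_anti₀ (sub_pos.2 (inv_lt_one_of_one_lt₀ (by linarith))) (by linarith)
    _ = 1 + t⁻¹ := by
        rw [inv_eq_iff_eq_inv]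
        field_simp
        ring

theorem sum_Ico_exp_neg_pow_le {t : ℝ} (ht : 0 < t) (k n : ℕ) :
    ∑ j ∈ Finset.Ico k n, Real.exp (-t) ^ j ≤ (1 + t⁻¹) * Real.exp (-t) ^ k := by
  calc ∑ j ∈ Finset.Ico k n, Real.exp (-t) ^ j ≤ Real.exp (-t) ^ k / (1 - Real.exp (-t)) :=
        geom_sum_Ico_le_of_lt_one (Real.exp_pos _).le (Real.exp_lt_one_iff.2 (neg_lt_zero.2 ht))
    _ ≤ (1 + t⁻¹) * Real.exp (-t) ^ k := by
        rw [div_eq_inv_mul]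
        gcongr
        exact inv_one_sub_exp_neg_le ht

theorem sum_eigenvalue_tail_le (hV : V * Vᵀ = 1) (hσ : Antitone σ)
    (hZ : ∀ j, spectralHankel L *ᵥ V j = σ j • V j) (hL : Nat.log 2 L + 5 ≤ 2 * Real.log L)
    (hk : k ≤ L) :
    ∑ j ∈ (Finset.univ.map (Fin.castLEEmb hk))ᶜ, σ j ≤
      (Real.exp 4 * (1 + Real.log L) * Real.exp (-(2 * (k / Real.log L)))) ^ 2 := by
  set ℓ := Real.log L
  have ℓ_pos : 0 < ℓ := by linarith [Nat.cast_nonneg (α := ℝ) (Nat.log 2 L)]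
  calc ∑ j ∈ (Finset.univ.map (Fin.castLEEmb hk))ᶜ, σ j
      ≤ ∑ j ∈ (Finset.univ.map (Fin.castLEEmb hk))ᶜ,
          Real.exp 8 * (1 + ℓ) * Real.exp (-(4 / ℓ)) ^ (j : ℕ) :=
        Finset.sum_le_sum fun j _ => eigenvalue_spectralHankel_le hV hσ hZ hL j
    _ = Real.exp 8 * (1 + ℓ) * ∑ j ∈ Finset.Ico k L, Real.exp (-(4 / ℓ)) ^ j := by
        rw [← Finset.mul_sum, sum_compl_map_castLEEmb hk fun j => Real.exp (-(4 / ℓ)) ^ j]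
    _ ≤ Real.exp 8 * (1 + ℓ) * ((1 + (4 / ℓ)⁻¹) * Real.exp (-(4 / ℓ)) ^ k) := by
        gcongr
        exact sum_Ico_exp_neg_pow_le (by positivity) k L
    _ ≤ Real.exp 8 * (1 + ℓ) * ((1 + ℓ) * Real.exp (-(4 / ℓ)) ^ k) := by
        gcongr
        rw [inv_div]
        linarith
    _ = (Real.exp 4 * (1 + ℓ) * Real.exp (-(2 * (k / ℓ)))) ^ 2 := by
        have exp_eight : Real.exp 8 = Real.exp 4 ^ 2 := by
          rw [← Real.exp_nat_mul]
          norm_num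
        have exp_pow : Real.exp (-(4 / ℓ)) ^ k = Real.exp (-(2 * (k / ℓ))) ^ 2 := by
          rw [← Real.exp_nat_mul, ← Real.exp_nat_mul]
          ring_nf
        rw [exp_eight, exp_pow]
        ring

end Tail

namespace IsSpectralFilters

variable {L k : ℕ} {Φ : Matrix (Fin k) (Fin L) ℝ} {α : ℝ}

theorem mul_transpose (h : IsSpectralFilters L k Φ) : Φ * Φᵀ = 1 := by
  obtain ⟨V, σ, hV, -, -, hk, hΦ⟩ := h
  obtain rfl : Φ = V.submatrix (Fin.castLE hk) id := funext hΦ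
  exact submatrix_mul_transpose_eq_one hV (Fin.castLE_injective hk)

theorem residualEnergy_le_one (h : IsSpectralFilters L k Φ) (hα : α ∈ Set.Icc (0 : ℝ) 1) :
    residualEnergy Φ (impulseResponse L α) ≤ 1 :=
  (residualEnergy_le_dotProduct_self h.mul_transpose _).trans
    (dotProduct_self_impulseResponse_le_one L hα)

theorem residualEnergy_le_of_natLog_le (h : IsSpectralFilters L k Φ)
    (hL : Nat.log 2 L + 5 ≤ 2 * Real.log L) (hα : α ∈ Set.Icc (0 : ℝ) 1) :
    residualEnergy Φ (impulseResponse L α) ≤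
      6 * Real.exp 4 * (1 + Real.log L) * Real.exp (-(2 * (k / Real.log L))) := by
  have pointwise := residualEnergy_impulseResponse_sq_le h.mul_transpose hα
  obtain ⟨V, σ, hV, hσ, hZ, hk, hΦ⟩ := h
  obtain rfl : Φ = V.submatrix (Fin.castLEEmb hk) id := funext hΦ
  rw [integral_residualEnergy_submatrix_impulseResponse hV hZ] at pointwise
  have tail := sum_eigenvalue_tail_le hV hσ hZ hL hk
  set T := Real.exp 4 * (1 + Real.log L) * Real.exp (-(2 * (k / Real.log L))) with hT
  calc _ ≤ 6 * T := le_of_sq_le_sq (by nlinarith [sq_nonneg T]) (by positivity)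
    _ = _ := by
        rw [hT]
        ring

end IsSpectralFilters

-- Short lengths and `k < log L` are absorbed in the constant: there `k / log L` is bounded.
theorem exists_residualEnergy_impulseResponse_le :
    ∃ C : ℝ, 0 < C ∧ ∀ {L k : ℕ} {Φ : Matrix (Fin k) (Fin L) ℝ} {α : ℝ}, 2 ≤ L →
      IsSpectralFilters L k Φ → α ∈ Set.Icc (0 : ℝ) 1 →
      residualEnergy Φ (impulseResponse L α) ≤
        C * (1 + k) * Real.exp (-(2 * (k / Real.log L))) := by
  obtain ⟨L₀, hL₀⟩ := Filter.eventually_atTop.1 <| eventually_natLog_add_le_mul_log (b := 2)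
    one_lt_two (c := 2) (by push_cast; linarith [Real.log_two_gt_d9]) 5
  set B := 2 * (L₀ / Real.log 2 + 1)
  refine ⟨Real.exp B + 6 * Real.exp 4, by positivity, fun {L k Φ α} hL h hα => ?_⟩
  have log_two_pos : 0 < Real.log 2 := Real.log_pos one_lt_two
  have log_two_le : Real.log 2 ≤ Real.log L := Real.log_le_log two_pos (by exact_mod_cast hL)
  have log_pos : 0 < Real.log L := log_two_pos.trans_le log_two_le
  set E := Real.exp (-(2 * (k / Real.log L)))
  have hk : k ≤ L := by
    obtain ⟨_, _, _, _, _, hk, _⟩ := h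
    exact hk
  by_cases hB : 2 * (k / Real.log L) ≤ B
  · calc residualEnergy Φ (impulseResponse L α) ≤ 1 := h.residualEnergy_le_one hα
      _ ≤ Real.exp B * 1 * E := by
          rw [mul_one, ← Real.exp_add]
          exact Real.one_le_exp (by linarith)
      _ ≤ (Real.exp B + 6 * Real.exp 4) * (1 + k) * E := by
          gcongr
          · linarith [Real.exp_pos 4]
          · linarith [Nat.cast_nonneg (α := ℝ) k]
  · have B_lt : L₀ / Real.log 2 + 1 < k / Real.log L := by linarith
    have log_le : Real.log L ≤ k := by
      rw [← one_le_div₀ log_pos]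
      have : 0 ≤ L₀ / Real.log 2 := by positivity
      linarith
    have L₀_le : L₀ ≤ L := by
      refine le_trans ?_ hk
      have : (L₀ : ℝ) / Real.log 2 ≤ k / Real.log 2 := by
        calc (L₀ : ℝ) / Real.log 2 ≤ k / Real.log L := by linarith
          _ ≤ k / Real.log 2 := by gcongr
      exact_mod_cast (div_le_div_iff_of_pos_right log_two_pos).1 this
    calc residualEnergy Φ (impulseResponse L α) ≤ 6 * Real.exp 4 * (1 + Real.log L) * E :=
          h.residualEnergy_le_of_natLog_le (hL₀ L L₀_le) hα
      _ ≤ (Real.exp B + 6 * Real.exp 4) * (1 + k) * E := by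
          gcongr
          linarith [Real.exp_pos B]

section SpectralRepresentation

variable {L k : ℕ} {ν : Measure (Fin L → ℝ)} {Φ : Matrix (Fin k) (Fin L) ℝ}

theorem IsWhite.exists_integral_dotProduct_sq_eq (hν : IsWhite ν) :
    ∃ s : ℝ, 0 < s ∧ ∀ w, ∫ u, (w ⬝ᵥ u) ^ 2 ∂ν = s * (w ⬝ᵥ w) := by
  obtain ⟨square_integrable, s, s_pos, hs⟩ := hν
  have covariance : (Matrix.of fun i j => ∫ u, u i * u j ∂ν) = s • (1 : Matrix (Fin L) _ ℝ) := by
    ext i j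
    simp [hs, Matrix.one_apply]
  refine ⟨s, s_pos, fun w => ?_⟩
  rw [integral_dotProduct_sq
    (fun i j => (square_integrable i).integrable_mul (square_integrable j)), covariance,
    Matrix.smul_mulVec, Matrix.one_mulVec, dotProduct_smul, smul_eq_mul]

theorem fitLoss_eq (hΦ : Φ * Φᵀ = 1) {s : ℝ}
    (hs : ∀ w, ∫ u, (w ⬝ᵥ u) ^ 2 ∂ν = s * (w ⬝ᵥ w)) (α : ℝ) (m : Fin k → ℝ) :
    fitLoss ν Φ α m = s * ((m - Φ *ᵥ impulseResponse L α) ⬝ᵥ (m - Φ *ᵥ impulseResponse L α) +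
      residualEnergy Φ (impulseResponse L α)) := by
  rw [← dotProduct_self_vecMul_sub hΦ, ← hs]
  simp only [fitLoss, sq_abs, Matrix.dotProduct_mulVec, sub_dotProduct]

theorem isSpectralRepresentation_iff (hν : IsWhite ν) (hΦ : Φ * Φᵀ = 1) (α : ℝ) (m : Fin k → ℝ) :
    IsSpectralRepresentation ν Φ α m ↔ m = Φ *ᵥ impulseResponse L α := by
  obtain ⟨s, s_pos, hs⟩ := hν.exists_integral_dotProduct_sq_eq
  simp only [IsSpectralRepresentation, fitLoss_eq hΦ hs, mul_le_mul_iff_right₀ s_pos,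
    add_le_add_iff_right]
  refine ⟨fun minimal => ?_, ?_⟩
  · have nonpos := minimal (Φ *ᵥ impulseResponse L α)
    rw [sub_self, dotProduct_zero] at nonpos
    exact sub_eq_zero.1 (dotProduct_self_eq_zero.1 (nonpos.antisymm (dotProduct_self_nonneg _)))
  · rintro rfl m'
    rw [sub_self, dotProduct_zero]
    exact dotProduct_self_nonneg _

theorem forall_isSpectralRepresentation_iff {h : ℕ} (hν : IsWhite ν) (hΦ : Φ * Φᵀ = 1)
    (α : Fin h → ℝ) (M : Matrix (Fin h) (Fin k) ℝ) :
    (∀ i, IsSpectralRepresentation ν Φ (α i) (M i)) ↔ M = impulseMatrix L α * Φᵀ := by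
  simp only [isSpectralRepresentation_iff hν hΦ, ← Matrix.vecMul_transpose]
  exact funext_iff.symm

end SpectralRepresentation

theorem exists_frobNorm_impulseMatrix_sub_le :
    ∃ c : ℝ, 0 < c ∧ ∀ {L k h : ℕ} {Φ : Matrix (Fin k) (Fin L) ℝ} {α : Fin h → ℝ}, 2 ≤ L → k ≤ h →
      IsSpectralFilters L k Φ → (∀ i, α i ∈ Set.Icc (0 : ℝ) 1) →
      frobNorm (impulseMatrix L α - impulseMatrix L α * Φᵀ * Φ) ≤
        c * h * Real.exp (-(k / Real.log L)) := by
  obtain ⟨C, C_pos, hC⟩ := exists_residualEnergy_impulseResponse_le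
  refine ⟨√(2 * C), by positivity, fun {L k h Φ α} hL hkh hΦ hα => ?_⟩
  refine Real.sqrt_le_iff.2 ⟨by positivity, ?_⟩
  have card_le : (h : ℝ) * (1 + k) ≤ 2 * h ^ 2 := by
    have : h * (1 + k) ≤ 2 * h ^ 2 := by
      rcases h.eq_zero_or_pos with rfl | h_pos
      · simp
      · nlinarith
    exact_mod_cast this
  have exp_sq : Real.exp (-(2 * (k / Real.log L))) = Real.exp (-(k / Real.log L)) ^ 2 := by
    rw [← Real.exp_nat_mul]
    ring_nf
  rw [sum_sub_mul_sq_eq_sum_residualEnergy]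
  calc ∑ i, residualEnergy Φ (impulseMatrix L α i)
      ≤ ∑ _i : Fin h, C * (1 + k) * Real.exp (-(2 * (k / Real.log L))) :=
        Finset.sum_le_sum fun i _ => hC hL hΦ (hα i)
    _ = C * (h * (1 + k)) * Real.exp (-(k / Real.log L)) ^ 2 := by
        rw [Finset.sum_const, Finset.card_univ, Fintype.card_fin, nsmul_eq_mul, exp_sq]
        ring
    _ ≤ C * (2 * h ^ 2) * Real.exp (-(k / Real.log L)) ^ 2 := by gcongr
    _ = (√(2 * C) * h * Real.exp (-(k / Real.log L))) ^ 2 := by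
        rw [mul_pow, mul_pow, Real.sq_sqrt (by positivity)]
        ring

theorem theorem1 :
    ∃ c : ℝ, 0 < c ∧
      ∀ (L k h : ℕ), 2 ≤ L → k ≤ h →
      ∀ (Φ : Matrix (Fin k) (Fin L) ℝ), IsSpectralFilters L k Φ →
      ∀ (ν : Measure (Fin L → ℝ)), IsProbabilityMeasure ν → IsWhite ν →
      ∀ (Ω : Type*) [MeasurableSpace Ω] (P : Measure Ω), IsProbabilityMeasure P →
      ∀ (α : Fin h → Ω → ℝ), (∀ i, Measurable (α i)) → iIndepFun α P →
        (∀ i, ∀ᵐ ω ∂P, α i ω ∈ Set.Icc (0 : ℝ) 1) →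
        (∀ i (x : ℝ), P {ω | α i ω = x} = 0) →
      ∀ᵐ ω ∂P,
        ∃ (M : Matrix (Fin h) (Fin k) ℝ) (Mt : Matrix (Fin k) (Fin h) ℝ),
          IsAlgorithmRun ν Φ (fun i => α i ω) M Mt ∧
          (∀ M' Mt', IsAlgorithmRun ν Φ (fun i => α i ω) M' Mt' → M' = M ∧ Mt' = Mt) ∧
          Mt * M = 1 ∧
          frobNorm (Φ - Mt * impulseMatrix L (fun i => α i ω)) ≤
            c * maxSingularValue Mt * (h : ℝ) * Real.exp (-((k : ℝ) / Real.log (L : ℝ))) := by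
  obtain ⟨c, c_pos, hc⟩ := exists_frobNorm_impulseMatrix_sub_le
  refine ⟨c, c_pos, ?_⟩
  intro L k h hL hkh Φ hΦ ν _ hν Ω _ P _ α α_measurable α_indep α_mem α_atomless
  have orthonormal := hΦ.mul_transpose
  filter_upwards [ae_all_iff.2 α_mem, ae_mulVec_injective_impulseMatrix_mul_transpose hkh
    orthonormal α_measurable α_indep α_atomless] with ω α_mem injective
  obtain ⟨Mt, pinv, leftInverse⟩ := exists_isMoorePenroseInverse_of_mulVec_injective injective
  have rows_iff := forall_isSpectralRepresentation_iff hν orthonormal fun i => α i ω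
  refine ⟨_, Mt, ⟨(rows_iff _).2 rfl, pinv⟩, fun M' Mt' run => ?_, leftInverse, ?_⟩
  · obtain rfl := (rows_iff M').1 run.rows
    exact ⟨rfl, run.pinv.unique pinv⟩
  · calc frobNorm (Φ - Mt * impulseMatrix L fun i => α i ω)
        ≤ maxSingularValue Mt * (c * h * Real.exp (-(k / Real.log L))) :=
          (frobNorm_sub_mul_le_of_leftInverse leftInverse Φ _).trans
            (mul_le_mul_of_nonneg_left (hc hL hkh hΦ α_mem) (maxSingularValue_nonneg Mt))
      _ = c * maxSingularValue Mt * h * Real.exp (-(k / Real.log L)) := by ring
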